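/- Let $k\to A$ be a homomorphism of finite type between noetherian commutative rings of characteristic zero (i.e. $\mathbb Z$ embeds in each). For an $A$-module $M$ and $N\ge 0$ let $$\mathcal J^N(M/k)=(A\otimes_k M)/I_{A/k}^{N+1}\cdot(A\otimes_k M),\qquad I_{A/k}=\ker(A\otimes_kA\to A,\ a\otimes b\mapsto ab),$$ regarded as an $A$-module through the first tensor factor, and let $d^N_{M/k}\colon M\to\mathcal J^N(M/k)$, $m\mapsto\overline{1\otimes m}$. For $A$-modules $M_1,M_2$ let $DO^N_{A/k}(M_1,M_2)$ be the set of $k$-linear maps $D\colon M_1\to M_2$ of the form $D=\widetilde D\circ d^N_{M_1/k}$ with $\widetilde D\colon\mathcal J^N(M_1/k)\to M_2$ an $A$-linear map (the differential operators of order $\le N$ relative to $k$). Say that a closed subset $Z\subseteq\operatorname{Spec}A$ has positive fibre dimension over $k$ if $Z\ne\emptyset$ and every nonempty fibre of $Z\to\operatorname{Spec}k$ has Krull dimension $\ge 1$. Say that an $A$-module $M$ is nontorsion if $M_\eta\neq 0$ for every minimal prime $\eta$ of $A$, and torsion if $M_\eta=0$ for every minimal prime $\eta$ of $A$ (if $A$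 is a domain, these say that $M$ is not, respectively is, a torsion module in the usual sense). **Theorem.** Assume that $\operatorname{Spec}A$ has positive fibre dimension over $k$, and let $M_1,M_2$ be finitely generated $A$-modules. Then the inclusion $$DO^N_{A/k}(M_1,M_2)\subsetneq DO^{N+1}_{A/k}(M_1,M_2)$$ is strict for every $N\ge 0$ in each of the following cases: 1. $\operatorname{ann}(M_1)=\operatorname{ann}(M_2)$ (for example $M_1=M_2$), and $\operatorname{supp}(M_1)$ has positive fibre dimension over $k$; 2. $M_1$ and $M_2$ are both nontorsion; 3. $M_1$ is nontorsion, $M_2$ is torsion, and $V(\operatorname{ann}(M_2))$ has positive fibre dimension over $k$. -/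

import Mathlib

open scoped TensorProduct

noncomputable section

namespace JetModule

section Jet

variable (k : Type*) {A : Type*} [CommRing k] [CommRing A] [Algebra k A]
variable (M : Type*) [AddCommGroup M] [Module k M] [Module A M] [IsScalarTower k A M]

/-- The action of the ring `A ⊗[k] A` on `A ⊗[k] M`, determined by
`(a ⊗ b) • (c ⊗ m) = (a * c) ⊗ (b • m)`. -/
def tensorAction : A ⊗[k] A →ₐ[A] Module.End A (A ⊗[k] M) :=
  (Module.endTensorEndAlgHom (R := k) (S := A) (A := A) (M := A) (N := M)).comp
    (Algebra.TensorProduct.map (Algebra.lmul A A) (Algebra.lsmul k k M))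

theorem tensorAction_tmul (a b c : A) (m : M) :
    tensorAction k M (a ⊗ₜ[k] b) (c ⊗ₜ[k] m) = (a * c) ⊗ₜ[k] (b • m) :=
  rfl

/-- The submodule `I ^ (N + 1) • (A ⊗[k] M)` of `A ⊗[k] M`, where `I` is the diagonal ideal,
the kernel of the multiplication map `A ⊗[k] A → A`. Here and below `A ⊗[k] M` is an
`A`-module through the first tensor factor. -/
def diagonalSubmodule (N : ℕ) : Submodule A (A ⊗[k] M) :=
  Submodule.span A
    {y | ∃ z ∈ (KaehlerDifferential.ideal k A) ^ (N + 1), ∃ x : A ⊗[k] M,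
      y = tensorAction k M z x}

/-- The `N`-th jet module `(A ⊗[k] M) / I ^ (N + 1) • (A ⊗[k] M)` of `M` relative to `k`, as an
`A`-module through the first tensor factor. -/
abbrev Jet (A : Type*) [CommRing A] [Algebra k A] (M : Type*) [AddCommGroup M] [Module k M]
    [Module A M] [IsScalarTower k A M] (N : ℕ) : Type _ :=
  (A ⊗[k] M) ⧸ diagonalSubmodule k (A := A) M N

/-- The universal derivation `M → Jet k A M N`, sending `m` to the class of `1 ⊗ m`. -/
def universalDerivation (A : Type*) [CommRing A] [Algebra k A] (M : Type*) [AddCommGroup M]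
    [Module k M] [Module A M] [IsScalarTower k A M] (N : ℕ) : M →ₗ[k] Jet k A M N :=
  ((diagonalSubmodule k (A := A) M N).mkQ.restrictScalars k).comp (TensorProduct.mk k A M 1)

end Jet

/-- The differential operators `M₁ → M₂` of order at most `N` relative to `k`: the `k`-linear maps
that factor as the universal derivation `M₁ → Jet k A M₁ N` followed by an `A`-linear map
`Jet k A M₁ N → M₂`. They form an `A`-submodule of the `k`-linear maps, where `A` acts through
the target. -/
def DO (k A : Type*) [CommRing k] [CommRing A] [Algebra k A]
    (M₁ : Type*) [AddCommGroup M₁] [Module k M₁] [Module A M₁] [IsScalarTower k A M₁]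
    (M₂ : Type*) [AddCommGroup M₂] [Module k M₂] [Module A M₂] [IsScalarTower k A M₂]
    (N : ℕ) : Submodule A (M₁ →ₗ[k] M₂) where
  carrier := {D | ∃ E : Jet k A M₁ N →ₗ[A] M₂,
    D = (E.restrictScalars k).comp (universalDerivation k A M₁ N)}
  zero_mem' := ⟨0, by ext; simp⟩
  add_mem' := by
    rintro _ _ ⟨E, rfl⟩ ⟨F, rfl⟩
    exact ⟨E + F, by ext; simp⟩
  smul_mem' := by
    rintro a _ ⟨E, rfl⟩
    exact ⟨a • E, by ext; simp⟩

/-- A subset `Z` of `Spec A` has positive fibre dimension over `Spec k` if it is nonempty and each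
nonempty fibre of `Z → Spec k` has Krull dimension at least one. -/
def HasPositiveFibreDim (k : Type*) {A : Type*} [CommRing k] [CommRing A] [Algebra k A]
    (Z : Set (PrimeSpectrum A)) : Prop :=
  Z.Nonempty ∧ ∀ p : PrimeSpectrum k,
    (Z ∩ PrimeSpectrum.comap (algebraMap k A) ⁻¹' {p}).Nonempty →
      1 ≤ topologicalKrullDim ↥(Z ∩ PrimeSpectrum.comap (algebraMap k A) ⁻¹' {p})

/-- `M` is nontorsion if it does not vanish at any generic point of `Spec A`, that is, the
localization of `M` at each minimal prime of `A` is nonzero. -/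
def IsNontorsion (A M : Type*) [CommRing A] [AddCommGroup M] [Module A M] : Prop :=
  ∀ η : PrimeSpectrum A, η.asIdeal ∈ minimalPrimes A → η ∈ Module.support A M

/-- `M` is torsion if it vanishes at every generic point of `Spec A`, that is, the localization
of `M` at each minimal prime of `A` is zero. -/
def IsTorsion (A M : Type*) [CommRing A] [AddCommGroup M] [Module A M] : Prop :=
  ∀ η : PrimeSpectrum A, η.asIdeal ∈ minimalPrimes A → η ∉ Module.support A M

end JetModule

end

/-!
In each of the three cases the support of `M₂` is contained in that of `M₁` and has positive fibre
dimension over `k`. This alone makes the inclusions strict.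

A generic point `p` of `supp M₂` whose image in `Spec k` is minimal has a proper specialization `r`
in its own fibre (`exists_lt_of_hasPositiveFibreDim`). Let `K = κ(p)` and let `F` be the residue
field of the image `q` of `p`. An element of `r` outside `p` is transcendental over `F`
(`transcendental_algebraMap_of_mem`); call it `t`. The diagonal ideal `m` of `K ⊗[F] K` is finitely
generated and contains the regular element `1 ⊗ t - t ⊗ 1`, so its powers decrease strictly by
Nakayama's lemma (`KaehlerDifferential.not_ideal_pow_le_pow_succ`). The argument does not depend on
the characteristic of `K`, which may be positive even though `k` contains the integers.

Hence there is a functional `φ` on `K ⊗[F] K` that vanishes on `m ^ (N + 2)` but not on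
`m ^ (N + 1)`. As `p` lies in the support of `M₁`, there is a nonzero `A`-linear map `g : M₁ → K`,
and `a ⊗ m ↦ φ (a ⊗ g m)` is an `A`-linear map from the jets of order `N + 1` to `K` that does not
vanish on the kernel of the projection to the jets of order `N` (`exists_linearMap_jet_ne_zero`).
Jet modules are finite over `A`, so denominators can be cleared and the map takes values in `A ⧸ p`.
Since `p` is an associated prime of `M₂`, it can be composed with an embedding `A ⧸ p → M₂`
(`exists_linearMap_apply_ne_zero_of_residueField`). The result is a differential operator of order
at most `N + 1` but not at most `N`.
-/

/-! ### Positive fibre dimension -/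

theorem exists_specializes_ne_of_one_le_topologicalKrullDim {X : Type*} [TopologicalSpace X]
    [QuasiSober X] (h : 1 ≤ topologicalKrullDim X) : ∃ x y : X, x ⤳ y ∧ ¬ y ⤳ x := by
  obtain ⟨S, T, hST⟩ := Order.one_le_krullDim_iff.mp h
  obtain ⟨y, hy⟩ := QuasiSober.sober S.isIrreducible S.isClosed
  obtain ⟨x, hx⟩ := QuasiSober.sober T.isIrreducible T.isClosed
  refine ⟨x, y, hx.specializes (hST.le hy.mem), fun hyx ↦ hST.not_ge ?_⟩
  have : closure {x} ≤ closure {y} := hyx.closure_subset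
  rwa [hx.def, hy.def] at this

/-- A closed subset `V(I)` of positive fibre dimension has a generic point `p` with a proper
specialization in its own fibre. The fibre of a generic point may consist of that point together
with specializations of generic points of other fibres, so `p` has to be chosen over a minimal
element among the images of the generic points. -/
theorem exists_lt_of_hasPositiveFibreDim {k A : Type*} [CommRing k] [CommRing A] [Algebra k A]
    [IsNoetherianRing A] {I : Ideal A}
    (h : JetModule.HasPositiveFibreDim k (PrimeSpectrum.zeroLocus (I : Set A))) :
    ∃ p r : PrimeSpectrum A, p.asIdeal ∈ I.minimalPrimes ∧ p < r ∧
      PrimeSpectrum.comap (algebraMap k A) p = PrimeSpectrum.comap (algebraMap k A) r := by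
  obtain ⟨⟨s, hs⟩, hdim⟩ := h
  have hle (a : PrimeSpectrum A) (ha : a ∈ PrimeSpectrum.zeroLocus (I : Set A)) :
      ∃ p : PrimeSpectrum A, p.asIdeal ∈ I.minimalPrimes ∧ p ≤ a := by
    obtain ⟨p, hp, hpa⟩ := Ideal.exists_minimalPrimes_le (I := I) (J := a.asIdeal) ha
    exact ⟨⟨p, hp.1.1⟩, hp, hpa⟩
  have hfin : {p : PrimeSpectrum A | p.asIdeal ∈ I.minimalPrimes}.Finite :=
    (Ideal.finite_minimalPrimes_of_isNoetherianRing A I).preimage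
      (fun _ _ _ _ h ↦ PrimeSpectrum.ext h)
  obtain ⟨p₀, hp₀, -⟩ := hle s hs
  obtain ⟨p, hp, hmin⟩ := hfin.exists_minimalFor
    (PrimeSpectrum.comap (algebraMap k A)) _ ⟨p₀, hp₀⟩
  set q := PrimeSpectrum.comap (algebraMap k A) p with hq
  have hd := hdim q ⟨p, hp.1.2, rfl⟩
  -- The fibre is the spectrum of the fibre ring, hence sober, and so are its closed subsets.
  have : QuasiSober ↥(PrimeSpectrum.comap (algebraMap k A) ⁻¹' {q}) :=
    (PrimeSpectrum.preimageHomeomorphFiber k A q).isClosedEmbedding.quasiSober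
  have : QuasiSober ↥(PrimeSpectrum.zeroLocus (I : Set A) ∩
      PrimeSpectrum.comap (algebraMap k A) ⁻¹' {q}) := by
    rw [Set.inter_comm]
    exact QuasiSober.inter_of_isClosed_of_quasiSober_left _ (PrimeSpectrum.isClosed_zeroLocus _)
  obtain ⟨x, y, hxy, hyx⟩ := exists_specializes_ne_of_one_le_topologicalKrullDim hd
  rw [subtype_specializes_iff, ← PrimeSpectrum.le_iff_specializes] at hxy hyx
  -- A generic point `p'` above `x` lies over a prime contained in `q`, hence over `q`.
  obtain ⟨p', hp', hp'x⟩ := hle x.1 x.2.1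
  have hq' : PrimeSpectrum.comap (algebraMap k A) p' ≤ q := by
    rw [← show _ = q from x.2.2]
    exact Ideal.comap_mono hp'x
  exact ⟨p', y, hp', lt_of_le_of_lt hp'x (lt_of_le_not_ge hxy hyx),
    (le_antisymm hq' (hmin hp' hq')).trans (show _ = q from y.2.2).symm⟩

/-! ### Powers of the diagonal ideal of a field extension -/

/-- The nonzero elements of an ideal that contracts to zero are transcendental over the fraction
field of the base: after division by a power of the element, an algebraic relation over the base
ring has a nonzero constant coefficient, which lies in the contraction of the ideal. -/
theorem transcendental_algebraMap_of_mem {R S F K : Type*} [CommRing R] [CommRing S] [IsDomain R]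
    [IsDomain S] [Field F] [Field K] [Algebra R S] [Algebra R F] [Algebra S K] [Algebra F K]
    [Algebra R K] [IsScalarTower R S K] [IsScalarTower R F K] [IsFractionRing R F]
    (hSK : Function.Injective (algebraMap S K)) {P : Ideal S} (hP : P.comap (algebraMap R S) = ⊥)
    {a : S} (ha : a ∈ P) (ha0 : a ≠ 0) : Transcendental F (algebraMap S K a) := by
  intro h
  rw [← IsFractionRing.isAlgebraic_iff R F K, isAlgebraic_algebraMap_iff hSK] at h
  exact Ideal.comap_ne_bot_of_algebraic_mem ha0 ha h hP

open Polynomial in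
/-- For `t` transcendental over `F`, the element `1 ⊗ t - t ⊗ 1` of `K ⊗[F] K` is regular. It is the
image of `1 ⊗ t - X ⊗ 1` under the base change along `F[X] → K`, `X ↦ t`, from the domain
`F[X] ⊗[F] K`, which is a polynomial ring over `K`, and this base change is flat because `K` is
torsion-free over `F[X]`. -/
theorem one_tmul_sub_tmul_one_mem_nonZeroDivisors {F K : Type*} [Field F] [Field K] [Algebra F K]
    {t : K} (ht : Transcendental F t) :
    (1 : K) ⊗ₜ[F] t - t ⊗ₜ[F] (1 : K) ∈ nonZeroDivisors (K ⊗[F] K) := by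
  algebraize [(aeval (R := F) t).toRingHom]
  have : IsScalarTower F F[X] K := .of_algebraMap_eq' (aeval (R := F) t).comp_algebraMap.symm
  have hX : algebraMap F[X] K X = t := aeval_X (R := F) t
  have hinj : Function.Injective (algebraMap F[X] K) := transcendental_iff_injective.mp ht
  have : Module.IsTorsionFree F[X] K := Module.isTorsionFree_iff_algebraMap_injective.mpr hinj
  let u : F[X] ⊗[F] K := 1 ⊗ₜ t - X ⊗ₜ 1
  have hu : u ≠ 0 := by
    intro h
    have : Algebra.TensorProduct.lift (aeval (R := F) (0 : K)) (AlgHom.id F K)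
      (fun _ _ ↦ .all _ _) u = 0 := by rw [h, map_zero]
    have ht0 : t = 0 := by simpa [u] using this
    exact ht (ht0 ▸ isAlgebraic_zero)
  have : IsDomain (F[X] ⊗[F] K) :=
    (((Algebra.TensorProduct.comm F F[X] K).toMulEquiv).trans
      (polyEquivTensor' F K).symm.toMulEquiv).isDomain K[X]
  have hflat : Function.Injective ((LinearMap.mulLeft F[X] u).lTensor K) :=
    Module.Flat.lTensor_preserves_injective_linearMap _ (mul_right_injective₀ hu)
  -- Under `e`, multiplication by `u` on the second factor becomes multiplication by the element in
  -- question.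
  let e := TensorProduct.AlgebraTensorModule.cancelBaseChange F F[X] K K K
  have he (w : K ⊗[F[X]] (F[X] ⊗[F] K)) :
      e ((LinearMap.mulLeft F[X] u).lTensor K w) = e w * (1 ⊗ₜ t - t ⊗ₜ 1) := by
    induction w with
    | zero => simp
    | add x y hx hy => rw [map_add, map_add, hx, hy, map_add, add_mul]
    | tmul x y =>
      induction y with
      | zero => simp
      | add y z hy hz =>
        rw [TensorProduct.tmul_add, map_add, map_add, hy, hz, map_add, add_mul]
      | tmul a b =>
        simp [e, u, sub_mul, mul_sub, TensorProduct.tmul_sub, Algebra.smul_def, hX]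
        ring_nf
  rw [mem_nonZeroDivisors_iff_right]
  intro z hz
  obtain ⟨w, rfl⟩ := e.surjective z
  rw [← he, EmbeddingLike.map_eq_zero_iff] at hz
  rw [hflat (hz.trans (map_zero _).symm), map_zero]

/-- If `m ^ n ≤ m ^ (n + 1)` for the diagonal ideal `m`, Nakayama's lemma gives `b ≡ 1` modulo `m`
with `b • m ^ n = 0`; but `m ^ n` contains a power of a regular element. -/
theorem KaehlerDifferential.not_ideal_pow_le_pow_succ {F K : Type*} [Field F] [Field K] [Algebra F K]
    [Algebra.EssFiniteType F K] {t : K} (ht : Transcendental F t) (n : ℕ) :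
    ¬ KaehlerDifferential.ideal F K ^ n ≤ KaehlerDifferential.ideal F K ^ (n + 1) := by
  intro h
  obtain ⟨b, hb, hb'⟩ := Submodule.exists_sub_one_mem_and_smul_eq_zero_of_fg_of_le_smul
    (KaehlerDifferential.ideal F K) (KaehlerDifferential.ideal F K ^ n)
    ((KaehlerDifferential.ideal_fg F K).pow) (h.trans_eq (pow_succ' _ _))
  have hu : (1 : K) ⊗ₜ[F] t - t ⊗ₜ[F] (1 : K) ∈ KaehlerDifferential.ideal F K :=
    KaehlerDifferential.one_smul_sub_smul_one_mem_ideal F t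
  have h0 : b = 0 := (pow_mem (one_tmul_sub_tmul_one_mem_nonZeroDivisors ht) n).2 _
    (hb' _ (Ideal.pow_mem_pow hu n))
  rw [h0, zero_sub, neg_mem_iff] at hb
  exact one_ne_zero (α := K) (by simpa using (RingHom.mem_ker.mp hb))

/-- A `K`-linear functional that vanishes on `m ^ (n + 1)` but not on `m ^ n`, for the diagonal ideal
`m`. As `m` annihilates `m ^ n / m ^ (n + 1)`, the ring `K ⊗[F] K` acts on `m ^ n` through the
multiplication map as far as the functional is concerned. -/
theorem exists_functional_diagonal_ideal_pow {F K : Type*} [Field F] [Field K] [Algebra F K] (n : ℕ)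
    (h : ¬ KaehlerDifferential.ideal F K ^ n ≤ KaehlerDifferential.ideal F K ^ (n + 1)) :
    ∃ φ : K ⊗[F] K →ₗ[K] K, (∀ z ∈ KaehlerDifferential.ideal F K ^ (n + 1), φ z = 0) ∧
      (∃ z ∈ KaehlerDifferential.ideal F K ^ n, φ z ≠ 0) ∧
      ∀ c, ∀ z ∈ KaehlerDifferential.ideal F K ^ n,
        φ (c * z) = Algebra.TensorProduct.lmul' (S := K) F c * φ z := by
  obtain ⟨z, hz, hz'⟩ := SetLike.not_le_iff_exists.mp h
  obtain ⟨φ, hφz, hφ⟩ := Submodule.exists_le_ker_of_notMem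
    (p := (KaehlerDifferential.ideal F K ^ (n + 1)).restrictScalars K) (v := z) hz'
  refine ⟨φ, fun z hz ↦ hφ hz, ⟨z, hz, hφz⟩, fun c z hz ↦ ?_⟩
  set μ := Algebra.TensorProduct.lmul' (S := K) F
  have hc : c - μ c ⊗ₜ 1 ∈ KaehlerDifferential.ideal F K := by
    rw [KaehlerDifferential.ideal, RingHom.mem_ker]
    simp [μ]
  have h0 : φ ((c - μ c ⊗ₜ 1) * z) = 0 :=
    hφ (show _ ∈ KaehlerDifferential.ideal F K ^ (n + 1) from
      (pow_succ' (KaehlerDifferential.ideal F K) n) ▸ Ideal.mul_mem_mul hc hz)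
  have h1 : (μ c ⊗ₜ[F] (1 : K)) * z = μ c • z := by
    rw [Algebra.smul_def]; rfl
  rw [sub_mul, map_sub, h1, map_smul, sub_eq_zero] at h0
  exact h0

/-! ### Linear maps on jet modules with values in a field -/

section

variable (k A F K : Type*) [CommRing k] [CommRing A] [Field F] [Field K] [Algebra k A]
  [Algebra k F] [Algebra k K] [Algebra A K] [Algebra F K] [IsScalarTower k A K] [IsScalarTower k F K]

/-- The ring homomorphism `A ⊗[k] A → K ⊗[F] K` induced by the commutative square formed by
`k → A → K` and `k → F → K`. -/
def tensorSelfMap : A ⊗[k] A →ₐ[k] K ⊗[F] K :=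
  Algebra.TensorProduct.productMap
    (((Algebra.TensorProduct.includeLeft : K →ₐ[F] K ⊗[F] K).restrictScalars k).comp
      (IsScalarTower.toAlgHom k A K))
    (((Algebra.TensorProduct.includeRight : K →ₐ[F] K ⊗[F] K).restrictScalars k).comp
      (IsScalarTower.toAlgHom k A K))

theorem tensorSelfMap_tmul (a b : A) :
    tensorSelfMap k A F K (a ⊗ₜ b) = algebraMap A K a ⊗ₜ algebraMap A K b := by
  simp [tensorSelfMap]

/-- If each element of `K` is a fraction of elements of `A`, the diagonal ideal of `K` over `F` is
generated by the image of the diagonal ideal of `A` over `k`. -/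
theorem map_tensorSelfMap_ideal
    (hK : ∀ c : K, ∃ a b : A, algebraMap A K b ≠ 0 ∧ c * algebraMap A K b = algebraMap A K a) :
    (KaehlerDifferential.ideal k A).map (tensorSelfMap k A F K) = KaehlerDifferential.ideal F K := by
  have hmem (a : A) : (1 : K) ⊗ₜ[F] algebraMap A K a - algebraMap A K a ⊗ₜ[F] (1 : K) ∈
      (KaehlerDifferential.ideal k A).map (tensorSelfMap k A F K) := by
    have := Ideal.mem_map_of_mem (tensorSelfMap k A F K)
      (KaehlerDifferential.one_smul_sub_smul_one_mem_ideal k a)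
    rwa [map_sub, tensorSelfMap_tmul, tensorSelfMap_tmul, map_one] at this
  apply le_antisymm
  · rw [← KaehlerDifferential.span_range_eq_ideal, Ideal.map_span, Ideal.span_le]
    rintro _ ⟨_, ⟨a, rfl⟩, rfl⟩
    simp only [map_sub, tensorSelfMap_tmul, map_one]
    exact KaehlerDifferential.one_smul_sub_smul_one_mem_ideal F _
  · rw [← KaehlerDifferential.span_range_eq_ideal F K, Ideal.span_le]
    rintro _ ⟨c, rfl⟩
    obtain ⟨a, b, hb, hab⟩ := hK c
    set β := algebraMap A K b
    -- For `c = a / b` the generator belonging to `c` is a combination of those belonging to `a`, `b`.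
    have key : (1 : K) ⊗ₜ[F] c - c ⊗ₜ[F] (1 : K) = (1 ⊗ₜ β⁻¹) *
        ((1 ⊗ₜ algebraMap A K a - algebraMap A K a ⊗ₜ 1) -
          (c ⊗ₜ 1) * (1 ⊗ₜ β - β ⊗ₜ 1)) := by
      simp only [mul_sub, Algebra.TensorProduct.tmul_mul_tmul, one_mul, mul_one, ← hab]
      simp [hb, mul_comm c β]
    change (1 : K) ⊗ₜ[F] c - c ⊗ₜ[F] (1 : K) ∈ _
    rw [key]
    exact Ideal.mul_mem_left _ _ (sub_mem (hmem a) (Ideal.mul_mem_left _ _ (hmem b)))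

variable {k A F K}

open JetModule in
/-- From an `A`-linear map `g : M → K` that does not vanish at `x` and a functional `φ` on `K ⊗[F] K`
separating consecutive powers of the diagonal ideal, the rule `a ⊗ m ↦ φ (a ⊗ g m)` gives a linear
map on the jets of order `N + 1` that does not vanish on the jets in `I ^ (N + 1) • (1 ⊗ x)`. -/
theorem exists_linearMap_jet_ne_zero
    (hK : ∀ c : K, ∃ a b : A, algebraMap A K b ≠ 0 ∧ c * algebraMap A K b = algebraMap A K a)
    (N : ℕ)
    (h : ¬ KaehlerDifferential.ideal F K ^ (N + 1) ≤ KaehlerDifferential.ideal F K ^ (N + 2))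
    {M : Type*} [AddCommGroup M] [Module k M] [Module A M] [IsScalarTower k A M]
    (g : M →ₗ[A] K) {x : M} (hx : g x ≠ 0) :
    ∃ (E : Jet k A M (N + 1) →ₗ[A] K), ∃ z ∈ KaehlerDifferential.ideal k A ^ (N + 1),
      E (Submodule.mkQ _ (tensorAction k M z (1 ⊗ₜ x))) ≠ 0 := by
  obtain ⟨φ, hφ, ⟨w, hw, hφw⟩, hlin⟩ := exists_functional_diagonal_ideal_pow (N + 1) h
  set ρ := tensorSelfMap k A F K
  have hρ (n : ℕ) : (KaehlerDifferential.ideal k A ^ n).map ρ =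
      KaehlerDifferential.ideal F K ^ n := by
    rw [Ideal.map_pow, map_tensorSelfMap_ideal k A F K hK]
  have hgk (c : k) (m : M) : g (c • m) = algebraMap k F c • g m := by
    rw [algebraMap_smul, ← algebraMap_smul A c m, map_smul, algebraMap_smul]
  let D : M →ₗ[k] K :=
    { toFun m := φ (1 ⊗ₜ g m)
      map_add' m m' := by rw [map_add, TensorProduct.tmul_add, map_add]
      map_smul' c m := by
        rw [hgk, TensorProduct.tmul_smul, LinearMap.map_smul_of_tower, algebraMap_smul,
          RingHom.id_apply] }
  let E₀ : A ⊗[k] M →ₗ[A] K :=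
    TensorProduct.AlgebraTensorModule.lift (LinearMap.toSpanSingleton A (M →ₗ[k] K) D)
  have hE₀ (z : A ⊗[k] A) (a : A) (m : M) :
      E₀ (tensorAction k M z (a ⊗ₜ m)) = φ (ρ z * (algebraMap A K a ⊗ₜ g m)) := by
    induction z with
    | zero => simp
    | add x y hx hy => rw [map_add, LinearMap.add_apply, map_add, hx, hy, map_add, add_mul, map_add]
    | tmul b c =>
      have : E₀ ((b * a) ⊗ₜ (c • m)) = (b * a) • φ (1 ⊗ₜ g (c • m)) := rfl
      rw [tensorAction_tmul, this, tensorSelfMap_tmul, Algebra.TensorProduct.tmul_mul_tmul,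
        ← map_mul, ← algebraMap_smul K (b * a), ← map_smul, TensorProduct.smul_tmul', smul_eq_mul,
        mul_one, map_smul, Algebra.smul_def]
  have hzero : diagonalSubmodule k (A := A) M (N + 1) ≤ LinearMap.ker E₀ := by
    refine Submodule.span_le.mpr ?_
    rintro _ ⟨z, hz, y, rfl⟩
    rw [SetLike.mem_coe, LinearMap.mem_ker]
    induction y with
    | zero => simp
    | add x y hx hy => rw [map_add, map_add, hx, hy, add_zero]
    | tmul a m =>
      rw [hE₀]
      exact hφ _ (Ideal.mul_mem_right _ _ (hρ (N + 2) ▸ Ideal.mem_map_of_mem ρ hz))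
  refine ⟨Submodule.liftQ _ E₀ hzero, ?_⟩
  -- Otherwise `φ` vanishes on the image of `I ^ (N + 1)`, because it takes the value `g x * φ (ρ z)`
  -- at `ρ z * (1 ⊗ g x)`, and then on the ideal generated by this image.
  by_contra! hcon
  have hφρ (z) (hz : z ∈ KaehlerDifferential.ideal k A ^ (N + 1)) : φ (ρ z) = 0 := by
    have := hcon z hz
    rw [Submodule.mkQ_apply, Submodule.liftQ_apply, hE₀, map_one, mul_comm,
      hlin _ _ (hρ (N + 1) ▸ Ideal.mem_map_of_mem ρ hz)] at this
    simpa [hx] using this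
  let J : Ideal (K ⊗[F] K) :=
    { carrier := {y | y ∈ KaehlerDifferential.ideal F K ^ (N + 1) ∧ φ y = 0}
      zero_mem' := ⟨zero_mem _, map_zero _⟩
      add_mem' ha hb := ⟨add_mem ha.1 hb.1, by rw [map_add, ha.2, hb.2, add_zero]⟩
      smul_mem' c y hy := ⟨Ideal.mul_mem_left _ c hy.1, by
        rw [smul_eq_mul, hlin c y hy.1, hy.2, mul_zero]⟩ }
  have hJ : KaehlerDifferential.ideal F K ^ (N + 1) ≤ J := by
    rw [← hρ, Ideal.map_le_iff_le_comap]
    exact fun z hz ↦ ⟨hρ (N + 1) ▸ Ideal.mem_map_of_mem ρ hz, hφρ z hz⟩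
  exact hφw (hJ hw).2

end

/-! ### Jet modules and the filtration by order -/

/-- The diagonal ideal `I` becomes nilpotent and stays finitely generated in the quotient by
`I ^ (n + 1)`, and the quotient by it is `A`. -/
theorem finite_quotient_ideal_pow (k A : Type*) [CommRing k] [CommRing A] [Algebra k A]
    [Algebra.EssFiniteType k A] (n : ℕ) :
    Module.Finite A ((A ⊗[k] A) ⧸ KaehlerDifferential.ideal k A ^ (n + 1)) := by
  set I := KaehlerDifferential.ideal k A
  have hI : I ^ (n + 1) ≤ I := Ideal.pow_le_self n.succ_ne_zero
  let f : (A ⊗[k] A) ⧸ I ^ (n + 1) →ₐ[A] A :=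
    Ideal.Quotient.liftₐ (I ^ (n + 1)) (Algebra.TensorProduct.lmul'' k) (fun a ha ↦ hI ha)
  have hf : RingHom.ker f = I.map (Ideal.Quotient.mk (I ^ (n + 1))) :=
    Ideal.ker_quotient_lift _ _
  refine Module.finite_of_surjective_of_ker_le_nilradical f (fun a ↦ ⟨algebraMap A _ a, by simp⟩)
    ?_ ?_
  · rw [hf, Ideal.map_le_iff_le_comap]
    intro a ha
    refine ⟨n + 1, ?_⟩
    rw [← map_pow]
    exact Ideal.Quotient.eq_zero_iff_mem.mpr (Ideal.pow_mem_pow ha _)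
  · rw [hf]
    exact (KaehlerDifferential.ideal_fg k A).map _

namespace JetModule

/-- `A ⊗[k] M` is generated over `A` by the pure tensors `1 ⊗ m`. -/
theorem linearMap_tensor_ext {k A M P : Type*} [CommRing k] [CommRing A] [Algebra k A]
    [AddCommGroup M] [Module k M] [AddCommGroup P] [Module A P]
    {f g : A ⊗[k] M →ₗ[A] P} (h : ∀ m, f (1 ⊗ₜ m) = g (1 ⊗ₜ m)) : f = g := by
  ext x
  induction x with
  | zero => simp
  | add x y hx hy => rw [map_add, map_add, hx, hy]
  | tmul a m => rw [← mul_one a, ← smul_eq_mul, ← TensorProduct.smul_tmul', map_smul, map_smul, h]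

section

variable {k A : Type*} [CommRing k] [CommRing A] [Algebra k A]
  {M : Type*} [AddCommGroup M] [Module k M] [Module A M] [IsScalarTower k A M]

variable (k A M) in
/-- `Jet k A M N` is generated by the images of the maps `z ↦ z • (1 ⊗ m)` on
`(A ⊗[k] A) ⧸ I ^ (N + 1)`, where `m` runs through generators of `M`. -/
theorem finite_jet [Algebra.EssFiniteType k A] [Module.Finite A M] (N : ℕ) :
    Module.Finite A (Jet k A M N) := by
  have hfin := finite_quotient_ideal_pow k A N
  let f (m : M) : A ⊗[k] A →ₗ[A] Jet k A M N :=
    (Submodule.mkQ _).comp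
      ((LinearMap.applyₗ (1 ⊗ₜ[k] m)).comp (tensorAction k M).toLinearMap)
  have hf (m : M) (z : A ⊗[k] A) : f m z = Submodule.mkQ _ (tensorAction k M z (1 ⊗ₜ m)) := rfl
  have hfg (m : M) : (LinearMap.range (f m)).FG := by
    have hker : (KaehlerDifferential.ideal k A ^ (N + 1)).restrictScalars A ≤
        LinearMap.ker (f m) := by
      intro z hz
      rw [LinearMap.mem_ker, hf, Submodule.mkQ_apply, Submodule.Quotient.mk_eq_zero]
      exact Submodule.subset_span ⟨z, hz, _, rfl⟩
    have : Module.Finite A ((A ⊗[k] A) ⧸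
      (KaehlerDifferential.ideal k A ^ (N + 1)).restrictScalars A) := hfin
    rw [← Submodule.range_liftQ _ (f m) hker, LinearMap.range_eq_map]
    exact Module.Finite.fg_top.map _
  obtain ⟨s, hs⟩ := Module.Finite.fg_top (R := A) (M := M)
  refine ⟨?_⟩
  have htop : (⊤ : Submodule A (Jet k A M N)) = ⨆ m ∈ s, LinearMap.range (f m) := by
    symm
    -- The elements `m` with this property form a submodule of `M`, as `z • (1 ⊗ a • m)` is
    -- `(z * (1 ⊗ a)) • (1 ⊗ m)`.
    have key (m : M) : ∀ z, f m z ∈ ⨆ m ∈ s, LinearMap.range (f m) := by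
      have hm : m ∈ Submodule.span A (s : Set M) := hs ▸ Submodule.mem_top
      induction hm using Submodule.span_induction with
      | mem x hx =>
        exact fun z ↦ Submodule.mem_iSup_of_mem x (Submodule.mem_iSup_of_mem hx ⟨z, rfl⟩)
      | zero => intro z; simp [hf]
      | add x y _ _ hx hy =>
        intro z
        rw [hf, TensorProduct.tmul_add, map_add, map_add]
        exact add_mem (hx z) (hy z)
      | smul a x _ hx =>
        intro z
        have h1 : (1 : A) ⊗ₜ[k] (a • x) = tensorAction k M (1 ⊗ₜ a) (1 ⊗ₜ x) := by
          rw [tensorAction_tmul, one_mul]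
        have := hx (z * 1 ⊗ₜ a)
        rwa [hf, map_mul, Module.End.mul_apply, ← h1] at this
    rw [eq_top_iff]
    rintro y -
    obtain ⟨y, rfl⟩ := Submodule.mkQ_surjective _ y
    induction y with
    | zero => simp
    | add x y hx hy => rw [map_add]; exact add_mem hx hy
    | tmul a m =>
      have := key m (a ⊗ₜ 1)
      rwa [hf, tensorAction_tmul, mul_one, one_smul] at this
  rw [htop]
  exact Submodule.fg_biSup s _ fun m _ ↦ hfg m

theorem diagonalSubmodule_succ_le (N : ℕ) :
    diagonalSubmodule k (A := A) M (N + 1) ≤ diagonalSubmodule k M N := by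
  refine Submodule.span_mono ?_
  rintro _ ⟨z, hz, x, rfl⟩
  exact ⟨z, Ideal.pow_le_pow_right (Nat.le_succ _) hz, x, rfl⟩

variable {M₂ : Type*} [AddCommGroup M₂] [Module k M₂] [Module A M₂] [IsScalarTower k A M₂]

theorem DO_le_succ (N : ℕ) : DO k A M M₂ N ≤ DO k A M M₂ (N + 1) := by
  rintro _ ⟨E, rfl⟩
  refine ⟨E.comp (Submodule.factor (diagonalSubmodule_succ_le N)), LinearMap.ext fun m ↦ ?_⟩
  have h : Submodule.factor (diagonalSubmodule_succ_le N) (universalDerivation k A M (N + 1) m) =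
      universalDerivation k A M N m := Submodule.factor_mk _ _
  exact congrArg E h.symm

/-- An `A`-linear map `E` on the jets of order `N + 1` that does not vanish on the kernel
`I ^ (N + 1) • (A ⊗[k] M)` of the projection to the jets of order `N` defines a differential
operator of order exactly `N + 1`, since the operator determines `E`. -/
theorem DO_lt_succ_of_apply_ne_zero {N : ℕ} (E : Jet k A M (N + 1) →ₗ[A] M₂) {z : A ⊗[k] A}
    (hz : z ∈ KaehlerDifferential.ideal k A ^ (N + 1)) {y : A ⊗[k] M}
    (hE : E (Submodule.mkQ _ (tensorAction k M z y)) ≠ 0) :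
    DO k A M M₂ N < DO k A M M₂ (N + 1) := by
  refine lt_of_le_not_ge (DO_le_succ N) fun hle ↦ hE ?_
  obtain ⟨E', hE'⟩ := hle ⟨E, rfl⟩
  have heq : E.comp (Submodule.mkQ _) = E'.comp (Submodule.mkQ _) :=
    linearMap_tensor_ext fun m ↦ LinearMap.congr_fun hE' m
  have h0 : Submodule.mkQ (diagonalSubmodule k M N) (tensorAction k M z y) = 0 :=
    (Submodule.Quotient.mk_eq_zero _).mpr (Submodule.subset_span ⟨z, hz, y, rfl⟩)
  have := LinearMap.congr_fun heq (tensorAction k M z y)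
  rwa [LinearMap.comp_apply, LinearMap.comp_apply, h0, map_zero] at this

end

end JetModule

/-! ### Maps into the residue field of an associated prime -/

/-- Clearing denominators: a nonzero linear map from a finite module to `κ(p) = Frac (A ⧸ p)` has a
multiple with values in `A ⧸ p`, hence in every module that contains a copy of `A ⧸ p`. -/
theorem exists_linearMap_apply_ne_zero_of_residueField {A J M : Type*} [CommRing A]
    [AddCommGroup J] [Module A J] [Module.Finite A J] [AddCommGroup M] [Module A M]
    (p : Ideal A) [p.IsPrime] {i : (A ⧸ p) →ₗ[A] M} (hi : Function.Injective i)
    (E : J →ₗ[A] p.ResidueField) {j : J} (hj : E j ≠ 0) : ∃ E' : J →ₗ[A] M, E' j ≠ 0 := by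
  obtain ⟨s, hs⟩ := Module.Finite.fg_top (R := A) (M := J)
  obtain ⟨⟨b, hb⟩, hint⟩ := IsLocalization.exist_integer_multiples
    (nonZeroDivisors (A ⧸ p)) s E
  obtain ⟨b, rfl⟩ := Ideal.Quotient.mk_surjective b
  let ι : (A ⧸ p) →ₗ[A] p.ResidueField := (IsScalarTower.toAlgHom A (A ⧸ p) _).toLinearMap
  have hι : Function.Injective ι := p.injective_algebraMap_quotient_residueField
  have hb' : algebraMap A p.ResidueField b ≠ 0 := by
    rw [Ne, Ideal.algebraMap_residueField_eq_zero, ← Ideal.Quotient.eq_zero_iff_mem]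
    exact nonZeroDivisors.ne_zero hb
  have hbj : b • E j ≠ 0 := by
    rw [Algebra.smul_def]
    exact mul_ne_zero hb' hj
  have hrange (x : J) : (b • E) x ∈ LinearMap.range ι := by
    have : Submodule.span A (s : Set J) ≤ (LinearMap.range ι).comap (b • E) := by
      refine Submodule.span_le.mpr fun x hx ↦ ?_
      obtain ⟨c, hc⟩ := hint x hx
      refine ⟨c, hc.trans ?_⟩
      simp [Algebra.smul_def]
    exact this (hs ▸ Submodule.mem_top)
  let e := LinearEquiv.ofInjective ι hι
  refine ⟨(i.comp e.symm.toLinearMap).comp ((b • E).codRestrict _ hrange), ?_⟩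
  rw [LinearMap.comp_apply, LinearMap.comp_apply, LinearEquiv.coe_coe, Ne,
    map_eq_zero_iff i hi, e.symm.map_eq_zero_iff, Subtype.ext_iff]
  exact hbj

theorem exists_linearMap_residueField_ne_zero {A M : Type*} [CommRing A] [AddCommGroup M]
    [Module A M] [Module.Finite A M] {p : PrimeSpectrum A} (hp : p ∈ Module.support A M) :
    ∃ (g : M →ₗ[A] p.asIdeal.ResidueField) (x : M), g x ≠ 0 := by
  have := (Module.mem_support_iff_nontrivial_residueField_tensorProduct p).mp hp
  obtain ⟨y, hy⟩ := exists_ne (0 : p.asIdeal.ResidueField ⊗[A] M)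
  obtain ⟨f, hf⟩ := not_forall.mp
    (mt (Module.forall_dual_apply_eq_zero_iff p.asIdeal.ResidueField y).mp hy)
  by_contra! h
  have h0 : f = 0 := by
    refine TensorProduct.AlgebraTensorModule.ext fun a m ↦ ?_
    rw [← mul_one a, ← smul_eq_mul, ← TensorProduct.smul_tmul', map_smul]
    have h1 : f (1 ⊗ₜ m) = 0 :=
      h ((f.restrictScalars A).comp (TensorProduct.mk A p.asIdeal.ResidueField M 1)) m
    rw [h1, smul_zero, LinearMap.zero_apply]
  exact hf (by rw [h0, LinearMap.zero_apply])

open JetModule in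
/-- If `M₂` contains a copy of `A ⧸ p` for a prime `p` in the support of `M₁` that has a proper
specialization in its fibre over `k`, the filtration by order is strict at each step. -/
theorem JetModule.DO_lt_DO_succ {k A M₁ M₂ : Type*} [CommRing k] [CommRing A] [Algebra k A]
    [Algebra.EssFiniteType k A]
    [AddCommGroup M₁] [Module k M₁] [Module A M₁] [IsScalarTower k A M₁] [Module.Finite A M₁]
    [AddCommGroup M₂] [Module k M₂] [Module A M₂] [IsScalarTower k A M₂]
    {p r : PrimeSpectrum A} (hpr : p < r)
    (hcomap : PrimeSpectrum.comap (algebraMap k A) p = PrimeSpectrum.comap (algebraMap k A) r)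
    (hp : p ∈ Module.support A M₁) {i : (A ⧸ p.asIdeal) →ₗ[A] M₂} (hi : Function.Injective i)
    (N : ℕ) : DO k A M₁ M₂ N < DO k A M₁ M₂ (N + 1) := by
  obtain ⟨p, hpp⟩ := p
  obtain ⟨r, hrp⟩ := r
  replace hpr : p < r := hpr
  let q := p.comap (algebraMap k A)
  have hqr : r.comap (algebraMap k A) = q := congr(($hcomap).asIdeal).symm
  let F := q.ResidueField
  let K := p.ResidueField
  let : Algebra F K := (Ideal.ResidueField.map q p (algebraMap k A) rfl).toAlgebra
  have : IsScalarTower k F K := .of_algebraMap_eq fun c ↦ by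
    rw [IsScalarTower.algebraMap_apply k A K]
    exact (Ideal.ResidueField.map_algebraMap q p (algebraMap k A) rfl c).symm
  have : Algebra.EssFiniteType k K := .comp k A K
  have : Algebra.EssFiniteType F K := .of_comp k F K
  obtain ⟨a, har, hap⟩ := SetLike.exists_of_lt hpr
  have htr : Transcendental F (algebraMap A K a) := by
    -- The prime `r ⧸ p` of `A ⧸ p` contracts to zero in `k ⧸ q`, and `a` is a nonzero element of it.
    have : p.LiesOver q := ⟨rfl⟩
    let : Algebra (k ⧸ q) K := ((algebraMap F K).comp (algebraMap (k ⧸ q) F)).toAlgebra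
    have : IsScalarTower (k ⧸ q) F K := .of_algebraMap_eq fun _ ↦ rfl
    have : IsScalarTower (k ⧸ q) (A ⧸ p) K := by
      refine .of_algebraMap_eq' (Ideal.Quotient.ringHom_ext (RingHom.ext fun c ↦ ?_))
      exact (IsScalarTower.algebraMap_apply k F K c).symm
    refine transcendental_algebraMap_of_mem (R := k ⧸ q) (S := A ⧸ p)
      p.injective_algebraMap_quotient_residueField (P := r.map (Ideal.Quotient.mk p)) ?_
      (Ideal.mem_map_of_mem _ har) (fun h ↦ hap (Ideal.Quotient.eq_zero_iff_mem.mp h))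
    rw [eq_bot_iff]
    intro c hc
    obtain ⟨c, rfl⟩ := Ideal.Quotient.mk_surjective c
    have hc' : algebraMap k A c ∈ r := by
      have : Ideal.Quotient.mk p (algebraMap k A c) ∈ r.map (Ideal.Quotient.mk p) := hc
      rwa [Ideal.mem_quotient_iff_mem hpr.le] at this
    exact Ideal.Quotient.eq_zero_iff_mem.mpr (hqr.le hc')
  have hK (c : K) : ∃ a b : A, algebraMap A K b ≠ 0 ∧ c * algebraMap A K b = algebraMap A K a := by
    obtain ⟨a, b, hb, rfl⟩ := IsFractionRing.div_surjective (A := A ⧸ p) c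
    obtain ⟨a, rfl⟩ := Ideal.Quotient.mk_surjective a
    obtain ⟨b, rfl⟩ := Ideal.Quotient.mk_surjective b
    have hb' : algebraMap A K b ≠ 0 := by
      rw [Ne, Ideal.algebraMap_residueField_eq_zero, ← Ideal.Quotient.eq_zero_iff_mem]
      exact nonZeroDivisors.ne_zero hb
    exact ⟨a, b, hb', div_mul_cancel₀ _ hb'⟩
  obtain ⟨g, x, hx⟩ := exists_linearMap_residueField_ne_zero hp
  obtain ⟨E, z, hz, hE⟩ := exists_linearMap_jet_ne_zero (k := k) (F := F) hK N
    (KaehlerDifferential.not_ideal_pow_le_pow_succ htr (N + 1)) g hx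
  have := finite_jet k A M₁ (N + 1)
  obtain ⟨E', hE'⟩ := exists_linearMap_apply_ne_zero_of_residueField p hi E hE
  exact DO_lt_succ_of_apply_ne_zero E' hz hE'

/-! ### Strictness of the inclusions -/

theorem JetModule.IsNontorsion.support_eq_univ {A M : Type*} [CommRing A] [AddCommGroup M]
    [Module A M] (h : IsNontorsion A M) : Module.support A M = Set.univ := by
  refine Set.eq_univ_of_forall fun P ↦ ?_
  obtain ⟨η, hη, hηP⟩ := Ideal.exists_minimalPrimes_le (I := ⊥) (J := P.asIdeal) bot_le
  exact Module.mem_support_mono (p := ⟨η, hη.1.1⟩) hηP (h ⟨η, hη.1.1⟩ hη)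

theorem mainTheorem1 {k A M₁ M₂ : Type*} [CommRing k] [CommRing A] [Algebra k A]
    [IsNoetherianRing k] [IsNoetherianRing A] [CharZero k] [CharZero A] [Algebra.FiniteType k A]
    [AddCommGroup M₁] [Module k M₁] [Module A M₁] [IsScalarTower k A M₁] [Module.Finite A M₁]
    [AddCommGroup M₂] [Module k M₂] [Module A M₂] [IsScalarTower k A M₂] [Module.Finite A M₂]
    (hA : JetModule.HasPositiveFibreDim k (Set.univ : Set (PrimeSpectrum A)))
    (hM : (Module.annihilator A M₁ = Module.annihilator A M₂ ∧
            JetModule.HasPositiveFibreDim k (Module.support A M₁)) ∨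
          (JetModule.IsNontorsion A M₁ ∧ JetModule.IsNontorsion A M₂) ∨
          (JetModule.IsNontorsion A M₁ ∧ JetModule.IsTorsion A M₂ ∧
            JetModule.HasPositiveFibreDim k
              (PrimeSpectrum.zeroLocus (Module.annihilator A M₂ : Set A))))
    (N : ℕ) :
    JetModule.DO k A M₁ M₂ N < JetModule.DO k A M₁ M₂ (N + 1) := by
  -- All that is used of the three cases is that `supp M₂` lies in `supp M₁` and has positive fibre
  -- dimension.
  suffices h : Module.support A M₂ ⊆ Module.support A M₁ ∧
      JetModule.HasPositiveFibreDim k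
        (PrimeSpectrum.zeroLocus (Module.annihilator A M₂ : Set A)) by
    obtain ⟨hle, hdim⟩ := h
    obtain ⟨p, r, hp, hpr, hcomap⟩ := exists_lt_of_hasPositiveFibreDim hdim
    obtain ⟨-, i, hi⟩ := (isAssociatedPrime_iff_exists_injective_linearMap _ _).mp
      (Module.associatedPrimes.minimalPrimes_annihilator_subset_associatedPrimes A M₂ hp)
    exact JetModule.DO_lt_DO_succ hpr hcomap
      (hle (Module.mem_support_iff_of_finite.mpr hp.1.2)) hi N
  rw [← Module.support_eq_zeroLocus]
  rcases hM with ⟨hann, hdim⟩ | ⟨h₁, h₂⟩ | ⟨h₁, -, hdim⟩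
  · have : Module.support A M₁ = Module.support A M₂ := by
      rw [Module.support_eq_zeroLocus, Module.support_eq_zeroLocus, hann]
    exact ⟨this.ge, this ▸ hdim⟩
  · refine ⟨h₁.support_eq_univ ▸ Set.subset_univ _, ?_⟩
    rwa [h₂.support_eq_univ]
  · exact ⟨h₁.support_eq_univ ▸ Set.subset_univ _,
      Module.support_eq_zeroLocus (R := A) (M := M₂) ▸ hdim⟩
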